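/- Let $n\ge 0$, let $B_n$ be the Boolean algebra of subsets of $\{1,\dots,n\}$ ordered by inclusion and ranked by cardinality, and let $\mathcal E(B_n)$ be its edge poset: its elements are the pairs $(x,y)$ with $x\lessdot y$ in $B_n$, its order is the reflexive transitive closure of the relation "$x\lessdot x'$ and $y\lessdot y'$" between $(x,y)$ and $(x',y')$, and its rank function is $\operatorname{rk}(x,y)=|x|$. Let $G$ be any subgroup of the group $\operatorname{Aut}(B_n)$ of order automorphisms of $B_n$, acting on $\mathcal E(B_n)$ by $g\cdot(x,y)=(gx,gy)$. Let $\mathcal E(B_n)/G$ be the quotient poset: its elements are the $G$-orbits, $\mathcal O\le\mathcal O'$ if and only if $e\le e'$ for some $e\in\mathcal O$, $e'\in\mathcal O'$, and the rank of an orbit is the common rank of its elements. Then $\mathcal E(B_n)/G$ is Peck. Here a finite graded poset $P$ of rank $N$ (all ranks lie in $\{0,\dots,N\}$, and ranks $0$ and $N$ both occur), with $p_i$ elements of rank $i$, is Peck if it is rank-symmetric ($p_i=p_{N-i}$ for all $0\le i\le N$), rank-unimodal ($p_0\le\cdots\le p_k\ge\cdots\ge p_N$ for some $0\le k\le N$),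 and strongly Sperner (for every $k$, no union of $k$ disjoint antichains of $P$ has more elements than the union of the $k$ largest ranks of $P$). The empty poset, which arises for $n=0$, is Peck by convention. -/

import Mathlib

/-!
Finite graded posets are partial orders with Mathlib's class `GradeOrder ℕ P`: a rank function
`grade ℕ : P → ℕ` that is strictly monotone and increases by exactly one along every covering pair
(covering in `ℕ` means being the successor).
The Boolean algebra `B_n` is `Finset (Fin n)` ordered by inclusion and ranked by cardinality, and
`Aut(B_n)` is the group of order automorphisms `Finset (Fin n) ≃o Finset (Fin n)`.
-/

section RankConditions

variable (P : Type*) [PartialOrder P] [GradeOrder ℕ P]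

/-- The rank number `p_i`: how many elements have rank `i`. -/
noncomputable def rankNumber (i : ℕ) : ℕ := {x : P | grade ℕ x = i}.ncard

/-- `P` is a graded poset of rank `N`: the ranks lie in `0, …, N`, and both `0` and `N` occur.
(An empty poset, for which no rank can occur, is allowed by convention.) -/
def IsOfRank (N : ℕ) : Prop :=
  (∀ x : P, grade ℕ x ≤ N) ∧
    (Nonempty P → (∃ x : P, grade ℕ x = 0) ∧ (∃ y : P, grade ℕ y = N))

/-- `p_i = p_{N-i}` for all `0 ≤ i ≤ N`. -/
def IsRankSymmetric (N : ℕ) : Prop :=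
  ∀ i ≤ N, rankNumber P i = rankNumber P (N - i)

/-- `p_0 ≤ p_1 ≤ ⋯ ≤ p_k ≥ p_{k+1} ≥ ⋯ ≥ p_N` for some `0 ≤ k ≤ N`. -/
def IsRankUnimodal (N : ℕ) : Prop :=
  ∃ k ≤ N, (∀ i < k, rankNumber P i ≤ rankNumber P (i + 1)) ∧
    ∀ i, k ≤ i → i < N → rankNumber P (i + 1) ≤ rankNumber P i

/-- No union of `k` pairwise disjoint antichains is larger than the union of the `k` largest ranks,
i.e. some `k` ranks together have at least as many elements as that union. -/
def IsKSperner (k : ℕ) : Prop :=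
  ∀ A : Fin k → Set P, (∀ j, IsAntichain (· ≤ ·) (A j)) →
    (∀ i j, i ≠ j → Disjoint (A i) (A j)) →
      ∃ S : Finset ℕ, S.card = k ∧ (⋃ j, A j).ncard ≤ ∑ i ∈ S, rankNumber P i

/-- `k`-Sperner for every `k`. -/
def IsStronglySperner : Prop := ∀ k : ℕ, IsKSperner P k

/-- A finite graded poset is Peck if it is rank-symmetric, rank-unimodal and strongly Sperner. -/
def IsPeck [Finite P] : Prop :=
  ∃ N : ℕ, IsOfRank P N ∧ IsRankSymmetric P N ∧ IsRankUnimodal P N ∧ IsStronglySperner P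

end RankConditions

section EdgePoset

/-- The elements of the edge poset `ℰ(P)`: the edges `x ⋖ y` of the Hasse diagram of `P`. -/
@[ext]
structure EdgePoset (P : Type*) [PartialOrder P] where
  fst : P
  snd : P
  covBy : fst ⋖ snd

/-- In a graded poset, `x ⋖ y` says the same as `x ≤ y` and `rk y = rk x + 1`. -/
theorem covBy_iff_le_and_grade {P : Type*} [PartialOrder P] [GradeOrder ℕ P] (x y : P) :
    x ⋖ y ↔ x ≤ y ∧ grade ℕ y = grade ℕ x + 1 := by
  constructor
  · intro h
    have := Nat.covBy_iff_add_one_eq.1 (h.grade ℕ)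
    exact ⟨h.le, this.symm⟩
  · rintro ⟨h, hr⟩
    refine ⟨lt_of_le_of_ne h ?_, fun z hxz hzy => ?_⟩
    · rintro rfl
      omega
    · have h1 := grade_strictMono (𝕆 := ℕ) hxz
      have h2 := grade_strictMono (𝕆 := ℕ) hzy
      omega

namespace EdgePoset

variable {P : Type*} [PartialOrder P]

/-- The covering relation of `ℰ(P)`: `(x, y) ⋖ (x', y')` if `x ⋖ x'` and `y ⋖ y'`. -/
def Cov (e e' : EdgePoset P) : Prop := e.fst ⋖ e'.fst ∧ e.snd ⋖ e'.snd

theorem fst_le_of_reach {e e' : EdgePoset P} (h : Relation.ReflTransGen Cov e e') :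
    e.fst ≤ e'.fst := by
  induction h with
  | refl => exact le_rfl
  | tail _ hc ih => exact ih.trans hc.1.le

theorem snd_le_of_reach {e e' : EdgePoset P} (h : Relation.ReflTransGen Cov e e') :
    e.snd ≤ e'.snd := by
  induction h with
  | refl => exact le_rfl
  | tail _ hc ih => exact ih.trans hc.2.le

/-- The order of `ℰ(P)` is the reflexive transitive closure of the covering relation `Cov`. -/
instance : PartialOrder (EdgePoset P) where
  le := Relation.ReflTransGen Cov
  le_refl _ := Relation.ReflTransGen.refl
  le_trans _ _ _ := Relation.ReflTransGen.trans
  le_antisymm _ _ h h' := EdgePoset.ext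
    (le_antisymm (fst_le_of_reach h) (fst_le_of_reach h'))
    (le_antisymm (snd_le_of_reach h) (snd_le_of_reach h'))

theorem le_def (e e' : EdgePoset P) : e ≤ e' ↔ Relation.ReflTransGen Cov e e' := Iff.rfl

theorem fst_lt_of_lt {e e' : EdgePoset P} (h : e < e') : e.fst < e'.fst := by
  rcases Relation.ReflTransGen.cases_tail ((le_def _ _).1 h.le) with h1 | ⟨c, h1, h2⟩
  · exact absurd h1.symm h.ne
  · exact (fst_le_of_reach h1).trans_lt h2.1.lt

theorem cov_of_covBy {e e' : EdgePoset P} (h : e ⋖ e') : Cov e e' := by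
  rcases Relation.ReflTransGen.cases_tail ((le_def _ _).1 h.le) with h1 | ⟨c, h1, h2⟩
  · exact absurd h1.symm h.lt.ne
  · have hc : c < e' := lt_of_le_of_ne ((le_def _ _).2 (Relation.ReflTransGen.single h2)) (by
      rintro rfl
      exact lt_irrefl _ h2.1.lt)
    have hec : e = c := by
      by_contra hne
      exact h.2 (lt_of_le_of_ne ((le_def _ _).2 h1) hne) hc
    rw [hec]
    exact h2

/-- `ℰ(P)` is graded by `rk (x, y) = rk x`. -/
instance [GradeOrder ℕ P] : GradeOrder ℕ (EdgePoset P) where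
  grade e := grade ℕ e.fst
  grade_strictMono _ _ h := grade_strictMono (fst_lt_of_lt h)
  covBy_grade _ _ h := (cov_of_covBy h).1.grade ℕ

instance [Finite P] : Finite (EdgePoset P) :=
  Finite.of_injective (fun e : EdgePoset P => (e.fst, e.snd)) fun _ _ h =>
    EdgePoset.ext (congrArg Prod.fst h) (congrArg Prod.snd h)

end EdgePoset

end EdgePoset

section Actions

/-- An action of a group on a graded poset is order-preserving and rank-preserving. -/
class IsGradedAction (G P : Type*) [Group G] [PartialOrder P] [GradeOrder ℕ P] [MulAction G P] :
    Prop where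
  smul_le_smul_iff' (g : G) (x y : P) : g • x ≤ g • y ↔ x ≤ y
  grade_smul' (g : G) (x : P) : grade ℕ (g • x) = grade ℕ x

variable {G P : Type*} [Group G] [PartialOrder P] [GradeOrder ℕ P] [MulAction G P]
  [IsGradedAction G P]

theorem IsGradedAction.smul_covBy (g : G) {x y : P} (h : x ⋖ y) : g • x ⋖ g • y := by
  rw [covBy_iff_le_and_grade] at h ⊢
  rw [IsGradedAction.smul_le_smul_iff', IsGradedAction.grade_smul', IsGradedAction.grade_smul']
  exact h

/-- The induced action on the edge poset: `g • (x, y) = (g • x, g • y)`. -/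
instance : MulAction G (EdgePoset P) where
  smul g e := ⟨g • e.fst, g • e.snd, IsGradedAction.smul_covBy g e.covBy⟩
  one_smul e := EdgePoset.ext (one_smul G e.fst) (one_smul G e.snd)
  mul_smul g h e := EdgePoset.ext (mul_smul g h e.fst) (mul_smul g h e.snd)

theorem EdgePoset.smul_le_smul (g : G) {e e' : EdgePoset P} (h : e ≤ e') : g • e ≤ g • e' := by
  have h' : Relation.ReflTransGen EdgePoset.Cov e e' := h
  change Relation.ReflTransGen EdgePoset.Cov (g • e) (g • e')
  clear h
  induction h' with
  | refl => exact Relation.ReflTransGen.refl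
  | tail _ hc ih =>
    exact ih.tail ⟨IsGradedAction.smul_covBy g hc.1, IsGradedAction.smul_covBy g hc.2⟩

instance : IsGradedAction G (EdgePoset P) where
  smul_le_smul_iff' g e e' := by
    refine ⟨fun h => ?_, EdgePoset.smul_le_smul g⟩
    simpa using EdgePoset.smul_le_smul g⁻¹ h
  grade_smul' g e := IsGradedAction.grade_smul' g e.fst

end Actions

section Quotient

/-- The elements of the quotient poset `P/G`: the orbits of `G` on `P`. -/
def QuotientPoset (G P : Type*) [Group G] [MulAction G P] : Type _ :=
  MulAction.orbitRel.Quotient G P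

namespace QuotientPoset

variable {G P : Type*} [Group G] [MulAction G P]

/-- The orbit of `x`. -/
def mk (x : P) : QuotientPoset G P := Quotient.mk (MulAction.orbitRel G P) x

theorem mk_eq_iff {x y : P} : (mk x : QuotientPoset G P) = mk y ↔ ∃ g : G, g • y = x :=
  Quotient.eq (r := MulAction.orbitRel G P)

theorem mk_surjective : Function.Surjective (mk : P → QuotientPoset G P) :=
  Quotient.mk_surjective

instance [Finite P] : Finite (QuotientPoset G P) :=
  Finite.of_surjective mk mk_surjective

variable [PartialOrder P]

/-- `O ≤ O'` if there are `x ∈ O` and `x' ∈ O'` with `x ≤ x'`. -/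
instance : LE (QuotientPoset G P) where
  le O O' := ∃ x x' : P, mk x = O ∧ mk x' = O' ∧ x ≤ x'

theorem le_def (O O' : QuotientPoset G P) :
    O ≤ O' ↔ ∃ x x' : P, mk x = O ∧ mk x' = O' ∧ x ≤ x' := Iff.rfl

variable [GradeOrder ℕ P] [IsGradedAction G P]

/-- The common rank of the elements of an orbit. -/
def rk (O : QuotientPoset G P) : ℕ :=
  Quotient.lift (s := MulAction.orbitRel G P) (fun x : P => grade ℕ x) (by
    rintro x y ⟨g, rfl⟩
    exact IsGradedAction.grade_smul' g y) O

theorem rk_mk (x : P) : rk (mk x : QuotientPoset G P) = grade ℕ x := rfl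

theorem rk_lt {x x' : P} (h : x ≤ x') (hne : (mk x : QuotientPoset G P) ≠ mk x') :
    rk (mk x : QuotientPoset G P) < rk (mk x' : QuotientPoset G P) := by
  rw [rk_mk, rk_mk]
  refine grade_strictMono (lt_of_le_of_ne h ?_)
  rintro rfl
  exact hne rfl

instance : PartialOrder (QuotientPoset G P) where
  le_refl O := by
    obtain ⟨x, rfl⟩ := mk_surjective O
    exact ⟨x, x, rfl, rfl, le_rfl⟩
  le_trans := by
    rintro _ _ _ ⟨x, y, rfl, rfl, hxy⟩ ⟨y', z, hy, rfl, hyz⟩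
    obtain ⟨g, rfl⟩ := mk_eq_iff.1 hy
    exact ⟨g • x, z, mk_eq_iff.2 ⟨g, rfl⟩, rfl,
      ((IsGradedAction.smul_le_smul_iff' g x y).2 hxy).trans hyz⟩
  le_antisymm := by
    rintro _ _ ⟨x, y, rfl, rfl, hxy⟩ ⟨y', x', hy, hx, hyx⟩
    by_contra hne
    have h1 := rk_lt hxy hne
    have h2 := rk_lt (G := G) hyx (by rw [hy, hx]; exact Ne.symm hne)
    rw [hy, hx] at h2
    omega

/-- `P/G` is graded by the common rank of the elements of each orbit. -/
instance : GradeOrder ℕ (QuotientPoset G P) where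
  grade := rk
  grade_strictMono := by
    intro O O' h
    obtain ⟨x, x', rfl, rfl, hxx⟩ := h.le
    exact rk_lt hxx h.ne
  covBy_grade := by
    intro O O' h
    obtain ⟨x, x', rfl, rfl, hxx⟩ := h.le
    refine CovBy.grade ℕ (a := x) (b := x') ⟨lt_of_le_of_ne hxx ?_, fun z hxz hzx => ?_⟩
    · rintro rfl
      exact h.lt.ne rfl
    · refine h.2 (c := mk z) (lt_of_le_of_ne ⟨x, z, rfl, rfl, hxz.le⟩ fun he => ?_)
        (lt_of_le_of_ne ⟨z, x', rfl, rfl, hzx.le⟩ fun he => ?_)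
      · exact (grade_strictMono (𝕆 := ℕ) hxz).ne (congrArg rk he)
      · exact (grade_strictMono (𝕆 := ℕ) hzx).ne (congrArg rk he)

end QuotientPoset

end Quotient

/-- Every subgroup of `Aut(B_n)` acts on `B_n` by evaluation, preserving order and rank. -/
instance (n : ℕ) (G : Subgroup (Finset (Fin n) ≃o Finset (Fin n))) :
    IsGradedAction G (Finset (Fin n)) where
  smul_le_smul_iff' g x y := (g : Finset (Fin n) ≃o Finset (Fin n)).le_iff_le
  grade_smul' g x := by
    have key : ∀ (f : Finset (Fin n) ≃o Finset (Fin n)) (s : Finset (Fin n)),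
        (f s).card = s.card := by
      intro f s
      induction s using Finset.induction_on with
      | empty => simpa using congrArg Finset.card f.map_bot
      | insert a s ha ih =>
        have hc : f s ⋖ f (insert a s) := (apply_covBy_apply_iff f).2 (Finset.covBy_insert ha)
        have h2 := Nat.covBy_iff_add_one_eq.1 (hc.grade ℕ)
        simp only [Finset.grade_eq] at h2
        rw [Finset.card_insert_of_notMem ha, ← h2, ih]
    exact key g x

/-!
Let `U` send a function `f` on the edges of `B_n` to the function whose value at `e'` is the sum of
`f e` over the edges `e ⋖ e'` with the same direction as `e'`, and let `D` be the transpose of `U`.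
In each fixed direction the edges form a Boolean lattice `B_{n-1}`, so `D U - U D` is multiplication
by `n - 1 - 2 i` in rank `i`, and the usual `sl₂` computation shows that `U ^ k` is injective on
functions of rank `i` whenever `2 i + k ≤ n - 1`. As `U` commutes with `G`, this injectivity passes
to the `G`-invariant functions, that is, to the functions on the quotient poset, whose rank numbers
are symmetric because complementation reverses the edges.

Injectivity bounds the rank of `U ^ k` from below. Conversely, the corank of `U ^ k` is at least the
size of any union `B` of `k` antichains: if `A` is the set of minimal elements of `B` and `F` is the
set of elements that are not below any element of `A`, then `U` maps the functions supported on
`A ∪ F` to functions supported on `F`, and `B \ A` is a subset of `F` of smaller height.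
-/

section SupportedOperators

variable {X K : Type*} [Semiring K]

/-- The operators whose matrix vanishes off the relation `r`: the value of `U f` at `y` only depends
on the values of `f` at the `x` with `r x y`. With `r` the order or the covering relation of a
poset this is the notion of an order-raising operator. -/
def IsSupportedOn (r : X → X → Prop) (U : Module.End K (X → K)) : Prop :=
  ∀ f y, (∀ x, r x y → f x = 0) → U f y = 0

theorem IsSupportedOn.mono {r s : X → X → Prop} {U : Module.End K (X → K)}
    (hU : IsSupportedOn r U) (hrs : ∀ x y, r x y → s x y) : IsSupportedOn s U :=
  fun f y hf => hU f y fun x hx => hf x (hrs x y hx)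

variable [Fintype X]

open Classical in
/-- The operator whose matrix is the indicator of the relation `r`. -/
noncomputable def relSum (K : Type*) [Semiring K] (r : X → X → Prop) : Module.End K (X → K) where
  toFun f y := ∑ x with r x y, f x
  map_add' f g := by ext y; simp only [Pi.add_apply, Finset.sum_add_distrib]
  map_smul' c f := by
    ext y; simp only [Pi.smul_apply, smul_eq_mul, Finset.mul_sum, RingHom.id_apply]

open Classical in
theorem relSum_apply (r : X → X → Prop) (f : X → K) (y : X) :
    relSum K r f y = ∑ x with r x y, f x := rfl

theorem isSupportedOn_relSum (r : X → X → Prop) : IsSupportedOn r (relSum K r) := by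
  classical
  intro f y hf
  exact Finset.sum_eq_zero fun x hx => hf x (Finset.mem_filter.1 hx).2

theorem relSum_dotProduct (r : X → X → Prop) (f g : X → K) :
    relSum K r f ⬝ᵥ g = f ⬝ᵥ relSum K (Function.swap r) g := by
  classical
  simp only [dotProduct, relSum_apply, Finset.sum_mul, Finset.mul_sum, Finset.sum_filter,
    ite_mul, zero_mul, mul_ite, mul_zero, Function.swap]
  exact Finset.sum_comm

end SupportedOperators

section ChainHeight

theorem chainHeight_iUnion_le {ι α : Type*} {r : α → α → Prop} {A : ι → Set α}
    (hA : ∀ i, IsAntichain r (A i)) : (⋃ i, A i).chainHeight r ≤ ENat.card ι := by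
  refine iSup_le fun ⟨C, hCA, hC⟩ => ?_
  choose c hc using fun x : C => Set.mem_iUnion.1 (hCA x.2)
  have hc_inj : Function.Injective c := by
    intro x y hxy
    by_contra hne
    have hne' : (x : α) ≠ y := Subtype.coe_ne_coe.2 hne
    have hy : (y : α) ∈ A (c x) := hxy ▸ hc y
    rcases hC x.2 y.2 hne' with h | h
    · exact hA _ (hc x) hy hne' h
    · exact hA _ hy (hc x) hne'.symm h
  exact ENat.card_le_card_of_injective hc_inj

theorem chainHeight_sdiff_minimal_le {α : Type*} [PartialOrder α] {B : Set α} (hB : B.Finite)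
    {k : ℕ∞} (hk : B.chainHeight (· ≤ ·) ≤ k + 1) :
    (B \ {x | Minimal (· ∈ B) x}).chainHeight (· ≤ ·) ≤ k := by
  refine iSup_le fun ⟨C, hCB, hC⟩ => ?_
  have hCB' : C ⊆ B := hCB.trans Set.sdiff_subset
  rcases C.eq_empty_or_nonempty with rfl | hne
  · simp only [Set.encard_empty, zero_le]
  obtain ⟨c, hc⟩ := (hB.subset hCB').exists_minimal hne
  have hc_le : ∀ x ∈ C, c ≤ x := fun x hx =>
    (hC.total hc.prop hx).elim id fun hxc => hc.le_of_le hx hxc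
  obtain ⟨b, hbB, hbc⟩ : ∃ b ∈ B, b < c := by
    by_contra! hnot
    exact (hCB hc.prop).2 (minimal_iff_forall_lt.2 ⟨hCB' hc.prop, fun y hy hyB => hnot y hyB hy⟩)
  have hbC : b ∉ C := fun hb => (hc_le b hb).not_gt hbc
  have hchain : IsChain (· ≤ ·) (insert b C) :=
    hC.insert fun x hx _ => Or.inl (hbc.le.trans (hc_le x hx))
  have hle : C.encard + 1 ≤ k + 1 := by
    rw [← Set.encard_insert_of_notMem hbC]
    exact (Set.encard_le_chainHeight_of_isChain _ _
      (Set.insert_subset hbB hCB') hchain).trans hk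
  exact (ENat.add_le_add_iff_right ENat.one_ne_top).1 hle

end ChainHeight

section SupportedFunctions

open Module

variable {K : Type*} [DivisionRing K]

theorem finrank_map_add_finrank_inf_ker {V W : Type*} [AddCommGroup V] [Module K V]
    [FiniteDimensional K V] [AddCommGroup W] [Module K W] (T : V →ₗ[K] W) (S : Submodule K V) :
    finrank K (S.map T) + finrank K ↥(S ⊓ T.ker) = finrank K S := by
  rw [← (T.domRestrict S).finrank_range_add_finrank_ker, LinearMap.range_domRestrict,
    LinearMap.ker_domRestrict, ← Submodule.map_comap_subtype, Submodule.finrank_map_subtype_eq]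

theorem finrank_map_add_finrank_le_of_le {V W : Type*} [AddCommGroup V] [Module K V]
    [FiniteDimensional K V] [AddCommGroup W] [Module K W] (T : V →ₗ[K] W) {S S' : Submodule K V}
    (h : S' ≤ S) : finrank K (S.map T) + finrank K S' ≤ finrank K S + finrank K (S'.map T) := by
  have hS := finrank_map_add_finrank_inf_ker T S
  have hS' := finrank_map_add_finrank_inf_ker T S'
  have hker : finrank K ↥(S' ⊓ T.ker) ≤ finrank K ↥(S ⊓ T.ker) :=
    Submodule.finrank_mono (inf_le_inf_right _ h)
  omega

theorem finrank_map_of_disjoint_ker {V W : Type*} [AddCommGroup V] [Module K V]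
    [AddCommGroup W] [Module K W] {T : V →ₗ[K] W} {S : Submodule K V} (h : Disjoint S T.ker) :
    finrank K (S.map T) = finrank K S := by
  rw [← LinearMap.range_domRestrict]
  exact LinearMap.finrank_range_of_inj (LinearMap.injective_domRestrict_iff.2 h)

variable {P : Type*} [Finite P]

theorem spanSubset_mono {S T : Set P} (h : S ⊆ T) : Pi.spanSubset K S ≤ Pi.spanSubset K T :=
  Submodule.span_mono (Set.image_mono h)

theorem disjoint_spanSubset {S T : Set P} (h : Disjoint S T) :
    Disjoint (Pi.spanSubset K S) (Pi.spanSubset K T) := by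
  rw [Submodule.disjoint_def]
  intro f hS hT
  ext p
  by_cases hp : p ∈ S
  · exact Pi.mem_spanSubset_iff.1 hT p (h.notMem_of_mem_left hp)
  · exact Pi.mem_spanSubset_iff.1 hS p hp

theorem IsSupportedOn.map_spanSubset_le {r : P → P → Prop} {U : Module.End K (P → K)}
    (hU : IsSupportedOn r U) {S T : Set P} (h : ∀ p q, p ∈ S → r p q → q ∈ T) :
    (Pi.spanSubset K S).map U ≤ Pi.spanSubset K T := by
  rintro _ ⟨f, hf, rfl⟩
  refine Pi.mem_spanSubset_iff.2 fun q hq => hU f q fun p hpq => ?_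
  exact Pi.mem_spanSubset_iff.1 hf p fun hp => hq (h p q hp hpq)

end SupportedFunctions

section Antichains

open Module

variable {K P : Type*} [DivisionRing K] [PartialOrder P] [Finite P] {U : Module.End K (P → K)}

theorem finrank_map_pow_add_ncard_le (hU : IsSupportedOn (· < ·) U) {k : ℕ} {X B : Set P}
    (hX : IsUpperSet X) (hBX : B ⊆ X) (hB : B.chainHeight (· ≤ ·) ≤ k) :
    finrank K ((Pi.spanSubset K X).map (U ^ k)) + B.ncard ≤ X.ncard := by
  induction k generalizing X B with
  | zero =>
    obtain rfl : B = ∅ := (Set.chainHeight_eq_zero_iff _ _).1 (nonpos_iff_eq_zero.1 hB)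
    rw [Set.ncard_empty, add_zero, ← Pi.dim_spanSubset (R := K)]
    exact Submodule.finrank_map_le _ _
  | succ k ih =>
    set A := {x | Minimal (· ∈ B) x}
    have hAB : A ⊆ B := fun a ha => ha.prop
    set F := X \ lowerClosure A
    have hFX : F ⊆ X := Set.sdiff_subset
    have hAF : Disjoint A F :=
      Set.disjoint_left.2 fun a ha haF => haF.2 (subset_lowerClosure ha)
    have hF_upper : IsUpperSet F := fun x y hxy hx =>
      ⟨hX hxy hx.1, fun hy => hx.2 ((lowerClosure A).lower hxy hy)⟩
    have hBF : B \ A ⊆ F := by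
      rintro b ⟨hb, hbA⟩
      refine ⟨hBX hb, fun ⟨a, ha, hba⟩ => hbA ?_⟩
      rwa [ha.eq_of_le hb hba]
    have hmap : (Pi.spanSubset K (A ∪ F)).map U ≤ Pi.spanSubset K F := by
      refine hU.map_spanSubset_le ?_
      rintro p q (hp | hp) hpq
      · exact ⟨hX hpq.le (hBX hp.prop), fun ⟨a, ha, hqa⟩ =>
          ha.not_lt hp.prop (hpq.trans_le hqa)⟩
      · exact hF_upper hpq.le hp
    have hmap_pow :
        finrank K ((Pi.spanSubset K (A ∪ F)).map (U ^ (k + 1))) ≤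
          finrank K ((Pi.spanSubset K F).map (U ^ k)) := by
      rw [pow_succ, Module.End.mul_eq_comp, Submodule.map_comp]
      exact Submodule.finrank_mono (Submodule.map_mono hmap)
    have hchain : (B \ A).chainHeight (· ≤ ·) ≤ k :=
      chainHeight_sdiff_minimal_le B.toFinite (by exact_mod_cast hB)
    have hrank := finrank_map_add_finrank_le_of_le (U ^ (k + 1))
      (spanSubset_mono (K := K) (Set.union_subset (hAB.trans hBX) hFX))
    rw [Pi.dim_spanSubset, Pi.dim_spanSubset, Set.ncard_union_eq hAF] at hrank
    have hcard := Set.ncard_sdiff_add_ncard_of_subset hAB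
    have hF_card := ih hF_upper hBF hchain
    omega

theorem ncard_iUnion_add_finrank_range_pow_le (hU : IsSupportedOn (· < ·) U) {k : ℕ}
    {A : Fin k → Set P} (hA : ∀ j, IsAntichain (· ≤ ·) (A j)) :
    (⋃ j, A j).ncard + finrank K (U ^ k).range ≤ Nat.card P := by
  have hchain : (⋃ j, A j).chainHeight (· ≤ ·) ≤ k := by
    simpa using chainHeight_iUnion_le hA
  have hspan : Pi.spanSubset K (Set.univ : Set P) = ⊤ :=
    Submodule.eq_top_iff'.2 fun f => Pi.mem_spanSubset_iff.2 fun p hp => absurd trivial hp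
  have hle := finrank_map_pow_add_ncard_le hU isUpperSet_univ (Set.subset_univ _) hchain
  rwa [hspan, Submodule.map_top, Set.ncard_univ, add_comm] at hle

end Antichains

section Lefschetz

open Module

section RankSpace

variable (K P : Type*) [DivisionRing K] [PartialOrder P] [GradeOrder ℕ P] [Finite P]

/-- The `i`-th graded piece of the space of functions `P → K`: the functions supported on the
elements of rank `i`. -/
noncomputable def rankSpace (i : ℕ) : Submodule K (P → K) :=
  Pi.spanSubset K {p : P | grade ℕ p = i}

variable {K P}

theorem mem_rankSpace_iff {i : ℕ} {f : P → K} :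
    f ∈ rankSpace K P i ↔ ∀ p, grade ℕ p ≠ i → f p = 0 :=
  Pi.mem_spanSubset_iff

theorem finrank_rankSpace (i : ℕ) : finrank K (rankSpace K P i) = rankNumber P i :=
  Pi.dim_spanSubset

variable (P) in
theorem sum_rankNumber (S : Finset ℕ) :
    ∑ i ∈ S, rankNumber P i = {p : P | grade ℕ p ∈ S}.ncard := by
  classical
  have := Fintype.ofFinite P
  simp only [rankNumber, Set.ncard_eq_toFinset_card', Set.toFinset_ofPred]
  rw [Finset.card_eq_sum_card_fiberwise (s := {p : P | grade ℕ p ∈ S}) (f := grade ℕ) (t := S)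
    fun p hp => (Finset.mem_filter.1 hp).2]
  refine Finset.sum_congr rfl fun i hi => congrArg Finset.card ?_
  ext p
  simp only [Finset.mem_filter, Finset.mem_univ, true_and]
  exact ⟨fun h => ⟨h ▸ hi, h⟩, And.right⟩

end RankSpace

variable {K P : Type*} [DivisionRing K] [PartialOrder P] [GradeOrder ℕ P]

theorem IsSupportedOn.pow {U : Module.End K (P → K)} (hU : IsSupportedOn (· ⋖ ·) U) (k : ℕ) :
    IsSupportedOn (fun p q => grade ℕ p + k = grade ℕ q) (U ^ k) := by
  induction k with
  | zero => exact fun f q hf => hf q rfl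
  | succ k ih =>
    intro f q hf
    rw [pow_succ', Module.End.mul_apply]
    exact hU _ q fun r hrq => ih f r fun p hpr => hf p <|
      (congrArg (· + 1) hpr).trans ((covBy_iff_le_and_grade r q).1 hrq).2.symm

variable [Finite P]

/-- The injectivity half of the hard Lefschetz property, for a poset of rank `N`: the power `U ^ k`
is injective on functions of rank `i` whenever `i + k ≤ N - i`. -/
def IsLefschetz (U : Module.End K (P → K)) (N : ℕ) : Prop :=
  ∀ i k, 2 * i + k ≤ N → ∀ f ∈ rankSpace K P i, (U ^ k) f = 0 → f = 0

variable {U : Module.End K (P → K)} {N : ℕ}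

theorem IsLefschetz.disjoint_ker_pow (hN : IsLefschetz U N) (hU : IsSupportedOn (· ⋖ ·) U)
    (k : ℕ) :
    Disjoint (Pi.spanSubset K {p : P | 2 * grade ℕ p + k ≤ N}) (U ^ k).ker := by
  rw [Submodule.disjoint_def]
  intro f hf hker
  ext p
  by_cases hp : 2 * grade ℕ p + k ≤ N
  swap
  · exact Pi.mem_spanSubset_iff.1 hf p hp
  let g : P → K := {q : P | grade ℕ q = grade ℕ p}.indicator f
  have hgf : ∀ q, grade ℕ q = grade ℕ p → g q = f q := fun _ hq =>
    Set.indicator_of_mem (by exact hq) f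
  have hg : g ∈ rankSpace K P (grade ℕ p) :=
    mem_rankSpace_iff.2 fun _ hq => Set.indicator_of_notMem (by exact hq) f
  suffices h : (U ^ k) g = 0 from
    (hgf p rfl).symm.trans (congrFun (hN _ k hp g hg h) p)
  ext q
  by_cases hq : grade ℕ p + k = grade ℕ q
  · have hfg : (U ^ k) (f - g) q = 0 := hU.pow k _ q fun r hr => by
      rw [Pi.sub_apply, hgf r (Nat.add_right_cancel (hr.trans hq.symm)), sub_self]
    rwa [map_sub, LinearMap.mem_ker.1 hker, zero_sub, Pi.neg_apply, neg_eq_zero] at hfg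
  · exact hU.pow k g q fun r hr => mem_rankSpace_iff.1 hg r fun h => hq (h ▸ hr)

theorem map_pow_rankSpace_le (hU : IsSupportedOn (· ⋖ ·) U) (i k : ℕ) :
    (rankSpace K P i).map (U ^ k) ≤ rankSpace K P (i + k) :=
  (hU.pow k).map_spanSubset_le fun p q (hp : grade ℕ p = i) hpq => by rw [← hp]; exact hpq.symm

theorem IsLefschetz.finrank_map_pow_rankSpace (hN : IsLefschetz U N) {i k : ℕ}
    (hik : 2 * i + k ≤ N) : finrank K ((rankSpace K P i).map (U ^ k)) = rankNumber P i := by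
  rw [← finrank_rankSpace (K := K)]
  exact finrank_map_of_disjoint_ker (Submodule.disjoint_def.2 (hN i k hik))

theorem IsLefschetz.rankNumber_le (hN : IsLefschetz U N) (hU : IsSupportedOn (· ⋖ ·) U) {i k : ℕ}
    (hik : 2 * i + k ≤ N) : rankNumber P i ≤ rankNumber P (i + k) := by
  rw [← hN.finrank_map_pow_rankSpace hik, ← finrank_rankSpace (K := K)]
  exact Submodule.finrank_mono (map_pow_rankSpace_le hU i k)

theorem IsLefschetz.isRankUnimodal (hN : IsLefschetz U N) (hU : IsSupportedOn (· ⋖ ·) U)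
    (hsymm : IsRankSymmetric P N) : IsRankUnimodal P N := by
  refine ⟨N / 2, Nat.div_le_self N 2, fun i hi => hN.rankNumber_le hU (by omega),
    fun i hi hiN => ?_⟩
  rw [hsymm i hiN.le, hsymm (i + 1) hiN, show N - i = N - (i + 1) + 1 by omega]
  exact hN.rankNumber_le hU (by omega)

theorem IsLefschetz.rankSpace_le_range_pow (hN : IsLefschetz U N) (hU : IsSupportedOn (· ⋖ ·) U)
    (hsymm : IsRankSymmetric P N) {j k : ℕ} (hj : j ≤ N) (hjk : N + k ≤ 2 * j) :
    rankSpace K P j ≤ (U ^ k).range := by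
  obtain ⟨i, rfl⟩ := Nat.exists_eq_add_of_le' hj
  obtain ⟨l, rfl⟩ : ∃ l, j = i + (k + l) := ⟨j - i - k, by omega⟩
  have hrank : finrank K ((rankSpace K P i).map (U ^ (k + l))) =
      finrank K (rankSpace K P (i + (k + l))) := by
    rw [hN.finrank_map_pow_rankSpace (by omega), finrank_rankSpace, hsymm i (by omega),
      Nat.add_sub_cancel_left]
  rw [← Submodule.eq_of_le_of_finrank_eq (map_pow_rankSpace_le hU i (k + l)) hrank, pow_add,
    Module.End.mul_eq_comp, Submodule.map_comp]
  exact LinearMap.map_le_range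

theorem IsLefschetz.ncard_add_ncard_le_finrank_range_pow (hN : IsLefschetz U N)
    (hU : IsSupportedOn (· ⋖ ·) U) (hsymm : IsRankSymmetric P N) (hP : ∀ p : P, grade ℕ p ≤ N)
    (k : ℕ) :
    {p : P | 2 * grade ℕ p + k ≤ N}.ncard + {p : P | N + k < 2 * grade ℕ p}.ncard ≤
      finrank K (U ^ k).range := by
  set low := {p : P | 2 * grade ℕ p + k ≤ N}
  set high := {p : P | N + k < 2 * grade ℕ p}
  have hhigh : Pi.spanSubset K high ≤ (U ^ k).range := by
    refine Submodule.span_le.2 ?_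
    rintro _ ⟨p, hp, rfl⟩
    exact hN.rankSpace_le_range_pow hU hsymm (hP p) (le_of_lt hp)
      (Submodule.subset_span (Set.mem_image_of_mem _ rfl))
  have hdisj : Disjoint ((Pi.spanSubset K low).map (U ^ k)) (Pi.spanSubset K high) := by
    refine (disjoint_spanSubset (disjoint_compl_left (a := high))).mono_left
      ((hU.pow k).map_spanSubset_le fun p q hp hpq => ?_)
    simp only [low, high, Set.mem_ofPred_eq, Set.mem_compl_iff] at hp ⊢
    omega
  rw [← Pi.dim_spanSubset (R := K), ← Pi.dim_spanSubset (R := K),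
    ← finrank_map_of_disjoint_ker (hN.disjoint_ker_pow hU k),
    ← Submodule.finrank_sup_add_finrank_inf_eq, hdisj.eq_bot, finrank_bot, add_zero]
  exact Submodule.finrank_mono (sup_le LinearMap.map_le_range hhigh)

theorem IsLefschetz.isStronglySperner (hN : IsLefschetz U N)
    (hU : IsSupportedOn (· ⋖ ·) U) (hsymm : IsRankSymmetric P N) (hP : ∀ p : P, grade ℕ p ≤ N) :
    IsStronglySperner P := by
  intro k A hA _
  set m := (N + 2 - k) / 2
  refine ⟨Finset.Ico m (m + k), by simp, ?_⟩
  have hA_card := ncard_iUnion_add_finrank_range_pow_le (hU.mono fun _ _ h => h.lt) hA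
  have hrank := hN.ncard_add_ncard_le_finrank_range_pow hU hsymm hP k
  set low := {p : P | 2 * grade ℕ p + k ≤ N}
  set high := {p : P | N + k < 2 * grade ℕ p}
  have hcover : (low ∪ high)ᶜ ⊆ {p : P | grade ℕ p ∈ Finset.Ico m (m + k)} := by
    intro p hp
    have := hP p
    simp only [low, high, Set.mem_compl_iff, Set.mem_union, Set.mem_ofPred_eq, not_or] at hp
    simp only [Set.mem_ofPred_eq, Finset.mem_Ico]
    omega
  have hmid := Set.ncard_le_ncard hcover
  have hunion := Set.ncard_union_le low high
  have hcompl := Set.ncard_add_ncard_compl (low ∪ high)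
  rw [sum_rankNumber]
  omega

theorem IsLefschetz.isPeck (hN : IsLefschetz U N) (hU : IsSupportedOn (· ⋖ ·) U)
    (hrank : IsOfRank P N) (hsymm : IsRankSymmetric P N) : IsPeck P :=
  ⟨N, hrank, hsymm, hN.isRankUnimodal hU hsymm, hN.isStronglySperner hU hsymm hrank.1⟩

theorem IsSupportedOn.apply_apply_mem_rankSpace {D : Module.End K (P → K)}
    (hU : IsSupportedOn (· ⋖ ·) U) (hD : IsSupportedOn (Function.swap (· ⋖ ·)) D)
    {i : ℕ} {f : P → K} (hf : f ∈ rankSpace K P i) : U (D f) ∈ rankSpace K P i := by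
  refine mem_rankSpace_iff.2 fun q hq => hU _ q fun p hpq => hD f p fun r hpr => ?_
  have hqr : grade ℕ q = grade ℕ r :=
    ((covBy_iff_le_and_grade p q).1 hpq).2.trans ((covBy_iff_le_and_grade p r).1 hpr).2.symm
  exact mem_rankSpace_iff.1 hf r (hqr ▸ hq)

end Lefschetz

section SlTwo

theorem IsSupportedOn.swap_of_adjoint {X K : Type*} [CommSemiring K] [Fintype X]
    {r : X → X → Prop} {U D : Module.End K (X → K)} (hU : IsSupportedOn r U)
    (hadj : ∀ f g, U f ⬝ᵥ g = f ⬝ᵥ D g) : IsSupportedOn (Function.swap r) D := by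
  classical
  intro g y hg
  rw [← single_one_dotProduct y (D g), ← hadj]
  refine Finset.sum_eq_zero fun x _ => ?_
  by_cases hyx : r y x
  · rw [hg x hyx, mul_zero]
  · rw [hU _ x fun z hzx => Pi.single_eq_of_ne (fun hzy : z = y => hyx (hzy ▸ hzx)) 1, zero_mul]

variable {K P : Type*} [Field K] [PartialOrder P] [GradeOrder ℕ P] [Finite P]
  {U D : Module.End K (P → K)} {N : ℕ}

theorem lowering_raising_pow_succ (hU : IsSupportedOn (· ⋖ ·) U)
    (hcomm : ∀ i, ∀ f ∈ rankSpace K P i, D (U f) = U (D f) + ((N : K) - 2 * i) • f)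
    {i : ℕ} {f : P → K} (hf : f ∈ rankSpace K P i) (k : ℕ) :
    D ((U ^ (k + 1)) f) =
      (U ^ (k + 1)) (D f) + (((k : K) + 1) * (N - 2 * i - k)) • (U ^ k) f := by
  induction k with
  | zero => simpa using hcomm i f hf
  | succ k ih =>
    have hmem : (U ^ (k + 1)) f ∈ rankSpace K P (i + (k + 1)) :=
      map_pow_rankSpace_le hU i (k + 1) (Submodule.mem_map_of_mem hf)
    rw [pow_succ' U (k + 1), Module.End.mul_apply, Module.End.mul_apply, hcomm _ _ hmem, ih,
      map_add, map_smul, ← Module.End.mul_apply U, ← Module.End.mul_apply U, ← pow_succ',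
      ← pow_succ', add_assoc, ← add_smul]
    congr 2
    push_cast
    ring

theorem isLefschetz_of_commutator [LinearOrder K] [IsStrictOrderedRing K] {P : Type*}
    [PartialOrder P] [GradeOrder ℕ P] [Fintype P] {U D : Module.End K (P → K)}
    (hU : IsSupportedOn (· ⋖ ·) U) (hadj : ∀ f g, U f ⬝ᵥ g = f ⬝ᵥ D g)
    (hcomm : ∀ i, ∀ f ∈ rankSpace K P i, D (U f) = U (D f) + ((N : K) - 2 * i) • f) :
    IsLefschetz U N := by
  intro i k
  induction k with
  | zero => exact fun _ f _ hf => hf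
  | succ k ih =>
    intro hik f hf hpow
    have hc : 0 < ((k : K) + 1) * (N - 2 * i - k) := by
      have : (2 * i + (k + 1) : K) ≤ N := by exact_mod_cast hik
      exact mul_pos (by positivity) (by linarith)
    set c := ((k : K) + 1) * (N - 2 * i - k)
    have hUDf : U (D f) + c • f = 0 := by
      refine ih (by omega) _ (add_mem
        (hU.apply_apply_mem_rankSpace (hU.swap_of_adjoint hadj) hf) (Submodule.smul_mem _ c hf)) ?_
      rw [map_add, map_smul, ← Module.End.mul_apply, ← pow_succ,
        ← lowering_raising_pow_succ hU hcomm hf, hpow, map_zero]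
    have hnorm : D f ⬝ᵥ D f + c * (f ⬝ᵥ f) = 0 := by
      rw [← hadj, ← smul_eq_mul, ← smul_dotProduct, ← add_dotProduct, hUDf, zero_dotProduct]
    have hff : f ⬝ᵥ f ≤ 0 := by
      have : 0 ≤ D f ⬝ᵥ D f := Finset.sum_nonneg fun p _ => mul_self_nonneg _
      nlinarith
    exact dotProduct_self_eq_zero.1 (hff.antisymm (Finset.sum_nonneg fun p _ => mul_self_nonneg _))

end SlTwo

section Shift

theorem notMem_insert_symm {α : Type*} [DecidableEq α] {a b : α} {s : Finset α} (ha : a ∉ s)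
    (hb : b ∉ insert a s) : a ∉ insert b s := by
  simp only [Finset.mem_insert, not_or] at hb ⊢
  exact ⟨Ne.symm hb.1, ha⟩

namespace EdgePoset

/-- The covering pairs of the edge poset that translate an edge to a disjoint one; this excludes the
pairs formed by two consecutive edges `x ⋖ y` and `y ⋖ z`. In the Boolean lattice the edges
`(s, s ∪ {a})` and `(t, t ∪ {b})` form such a pair when `a = b` and `s ⋖ t`. -/
def IsShift {P : Type*} [PartialOrder P] (e e' : EdgePoset P) : Prop :=
  Cov e e' ∧ e.snd ≠ e'.fst

theorem IsShift.covBy {P : Type*} [PartialOrder P] [GradeOrder ℕ P] {e e' : EdgePoset P}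
    (h : IsShift e e') : e ⋖ e' :=
  (covBy_iff_le_and_grade e e').2
    ⟨(le_def e e').2 (Relation.ReflTransGen.single h.1), ((covBy_iff_le_and_grade _ _).1 h.1.1).2⟩

variable {α : Type*} [DecidableEq α]

/-- The edge of the Boolean lattice with lower end `s` and direction `a`. -/
@[simps]
def ofNotMem {a : α} {s : Finset α} (h : a ∉ s) : EdgePoset (Finset α) :=
  ⟨s, insert a s, Finset.covBy_insert h⟩

theorem exists_eq_ofNotMem (e : EdgePoset (Finset α)) : ∃ a s, ∃ h : a ∉ s, e = ofNotMem h := by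
  obtain ⟨a, ha, hsnd⟩ := Finset.covBy_iff_exists_insert.1 e.covBy
  exact ⟨a, e.fst, ha, EdgePoset.ext rfl hsnd.symm⟩

theorem isShift_ofNotMem_iff {a b : α} {s t : Finset α} (ha : a ∉ s) (hb : b ∉ t) :
    IsShift (ofNotMem ha) (ofNotMem hb) ↔ a = b ∧ s ⋖ t := by
  constructor
  · rintro ⟨⟨hst, hab⟩, hne⟩
    refine ⟨?_, hst⟩
    obtain ⟨c, -, rfl⟩ := Finset.covBy_iff_exists_insert.1 hst
    have hmem : a ∈ insert b (insert c s) := hab.le (Finset.mem_insert_self a s)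
    rcases Finset.mem_insert.1 hmem with hab | hac
    · exact hab
    · have hac' : a = c := (Finset.mem_insert.1 hac).resolve_right ha
      exact absurd (congrArg (insert · s) hac') hne
  · rintro ⟨rfl, hst⟩
    obtain ⟨c, hc, rfl⟩ := Finset.covBy_iff_exists_insert.1 hst
    have hca : c ∉ insert a s := notMem_insert_symm hc hb
    refine ⟨⟨hst, ?_⟩, fun h => hb (h.le (Finset.mem_insert_self a s))⟩
    change insert a s ⋖ insert a (insert c s)
    rw [Finset.insert_comm]
    exact Finset.covBy_insert hca

variable {K : Type*}

/-- The values of `f` on the edges in direction `a`, as a function of the lower end of the edge,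
extended by zero to the sets that contain `a`. -/
def along [Zero K] (f : EdgePoset (Finset α) → K) (a : α) (s : Finset α) : K :=
  if h : a ∉ s then f (ofNotMem h) else 0

theorem along_of_notMem [Zero K] (f : EdgePoset (Finset α) → K) {a : α} {s : Finset α}
    (h : a ∉ s) : along f a s = f (ofNotMem h) :=
  dif_pos h

variable [Semiring K] [Fintype (EdgePoset (Finset α))]

theorem relSum_isShift_ofNotMem (f : EdgePoset (Finset α) → K) {a : α} {s : Finset α}
    (h : a ∉ s) : relSum K IsShift f (ofNotMem h) = ∑ b ∈ s, along f a (s.erase b) := by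
  classical
  have hmem (b : α) : a ∉ s.erase b := fun hb => h (Finset.mem_of_mem_erase hb)
  refine (Finset.sum_bij (fun b _ => ofNotMem (hmem b)) (fun b hb => ?_)
    (fun b hb c hc hbc => ?_) (fun e he => ?_) fun b _ => along_of_notMem f (hmem b)).symm
  · simp only [Finset.mem_filter, Finset.mem_univ, true_and, isShift_ofNotMem_iff]
    exact Finset.erase_covBy hb
  · exact Finset.erase_injOn s hb hc (congrArg fst hbc)
  · obtain ⟨c, t, hc, rfl⟩ := exists_eq_ofNotMem e
    obtain ⟨rfl, hts⟩ := (isShift_ofNotMem_iff hc h).1 (Finset.mem_filter.1 he).2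
    obtain ⟨b, hb, rfl⟩ := Finset.covBy_iff_exists_erase.1 hts
    exact ⟨b, hb, rfl⟩

theorem relSum_swap_isShift_ofNotMem [Fintype α] (f : EdgePoset (Finset α) → K) {a : α}
    {s : Finset α} (h : a ∉ s) :
    relSum K (Function.swap IsShift) f (ofNotMem h) =
      ∑ b ∈ (insert a s)ᶜ, along f a (insert b s) := by
  classical
  have hmem (b : α) (hb : b ∈ (insert a s)ᶜ) : b ∉ s ∧ a ∉ insert b s :=
    ⟨fun hbs => Finset.mem_compl.1 hb (Finset.mem_insert_of_mem hbs),
      notMem_insert_symm h (Finset.mem_compl.1 hb)⟩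
  refine (Finset.sum_bij (fun b hb => ofNotMem (hmem b hb).2) (fun b hb => ?_)
    (fun b hb c hc hbc => ?_) (fun e he => ?_) fun b hb => along_of_notMem f (hmem b hb).2).symm
  · simp only [Finset.mem_filter, Finset.mem_univ, true_and, Function.swap, isShift_ofNotMem_iff]
    exact Finset.covBy_insert (hmem b hb).1
  · exact (Finset.insert_inj (hmem b hb).1).1 (congrArg fst hbc)
  · obtain ⟨c, t, hc, rfl⟩ := exists_eq_ofNotMem e
    obtain ⟨rfl, hst⟩ := (isShift_ofNotMem_iff h hc).1 (Finset.mem_filter.1 he).2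
    obtain ⟨b, hb, rfl⟩ := Finset.covBy_iff_exists_insert.1 hst
    exact ⟨b, Finset.mem_compl.2 (notMem_insert_symm hb hc), rfl⟩

end EdgePoset

theorem sum_sum_erase_insert_add_card_nsmul {α M : Type*} [DecidableEq α] [AddCommMonoid M]
    {s t : Finset α} (hst : Disjoint s t) (F : Finset α → M) :
    ∑ b ∈ t, ∑ c ∈ insert b s, F ((insert b s).erase c) + s.card • F s =
      ∑ c ∈ s, ∑ b ∈ insert c t, F (insert b (s.erase c)) + t.card • F s := by
  have hleft : ∀ b ∈ t, ∑ c ∈ insert b s, F ((insert b s).erase c) =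
      F s + ∑ c ∈ s, F ((insert b s).erase c) := fun b hb => by
    have hbs : b ∉ s := Finset.disjoint_right.1 hst hb
    rw [Finset.sum_insert hbs, Finset.erase_insert hbs]
  have hright : ∀ c ∈ s, ∑ b ∈ insert c t, F (insert b (s.erase c)) =
      F s + ∑ b ∈ t, F ((insert b s).erase c) := fun c hc => by
    rw [Finset.sum_insert (Finset.disjoint_left.1 hst hc), Finset.insert_erase hc]
    congr 1
    refine Finset.sum_congr rfl fun b hb => ?_
    rw [Finset.erase_insert_of_ne]
    rintro rfl
    exact Finset.disjoint_left.1 hst hc hb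
  rw [Finset.sum_congr rfl hleft, Finset.sum_congr rfl hright, Finset.sum_add_distrib,
    Finset.sum_add_distrib, Finset.sum_const, Finset.sum_const, Finset.sum_comm]
  abel

namespace EdgePoset

variable {α : Type*} [Fintype α] [DecidableEq α]

theorem card_compl_snd_add_card_fst (e : EdgePoset (Finset α)) :
    e.sndᶜ.card + e.fst.card = Fintype.card α - 1 := by
  have hcard : e.snd.card = e.fst.card + 1 := ((covBy_iff_le_and_grade _ _).1 e.covBy).2
  have := Finset.card_add_card_compl e.snd
  omega

variable {K : Type*} [Fintype (EdgePoset (Finset α))]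

theorem relSum_isShift_commutator [CommRing K] (f : EdgePoset (Finset α) → K)
    (e : EdgePoset (Finset α)) :
    relSum K (Function.swap IsShift) (relSum K IsShift f) e =
      relSum K IsShift (relSum K (Function.swap IsShift) f) e +
        ((e.sndᶜ.card : K) - e.fst.card) * f e := by
  obtain ⟨a, s, ha, rfl⟩ := exists_eq_ofNotMem e
  have hswap : ∀ c ∈ s, (insert a (s.erase c))ᶜ = insert c (insert a s)ᶜ := fun c hc => by
    rw [← Finset.compl_erase, Finset.erase_insert_of_ne fun h : a = c => ha (h ▸ hc)]
  have hUp : ∀ b ∈ (insert a s)ᶜ, along (relSum K IsShift f) a (insert b s) =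
      ∑ c ∈ insert b s, along f a ((insert b s).erase c) := fun b hb => by
    rw [along_of_notMem _ (notMem_insert_symm ha (Finset.mem_compl.1 hb)), relSum_isShift_ofNotMem]
  have hDown : ∀ c ∈ s, along (relSum K (Function.swap IsShift) f) a (s.erase c) =
      ∑ b ∈ insert c (insert a s)ᶜ, along f a (insert b (s.erase c)) := fun c hc => by
    rw [along_of_notMem _ fun h => ha (Finset.mem_of_mem_erase h), relSum_swap_isShift_ofNotMem,
      hswap c hc]
  have hsum := sum_sum_erase_insert_add_card_nsmul
    (disjoint_compl_right.mono_left (Finset.subset_insert a s)) (along f a)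
  rw [relSum_swap_isShift_ofNotMem, relSum_isShift_ofNotMem, Finset.sum_congr rfl hUp,
    Finset.sum_congr rfl hDown]
  rw [along_of_notMem f ha, nsmul_eq_mul, nsmul_eq_mul] at hsum
  simp only [ofNotMem_fst, ofNotMem_snd]
  linear_combination hsum

end EdgePoset

theorem EdgePoset.isLefschetz_relSum_isShift {α K : Type*} [Fintype α]
    [Fintype (EdgePoset (Finset α))] [Field K] [LinearOrder K] [IsStrictOrderedRing K] :
    IsLefschetz (relSum K (IsShift (P := Finset α))) (Fintype.card α - 1) := by
  classical
  refine isLefschetz_of_commutator (D := relSum K (Function.swap IsShift))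
    ((isSupportedOn_relSum _).mono fun _ _ h => h.covBy) (relSum_dotProduct _) fun i f hf => ?_
  ext e
  rw [relSum_isShift_commutator, Pi.add_apply, Pi.smul_apply, smul_eq_mul]
  by_cases he : grade ℕ e = i
  · have hfst : e.fst.card = i := he
    rw [← card_compl_snd_add_card_fst e, hfst]
    push_cast
    ring
  · rw [mem_rankSpace_iff.1 hf e he, mul_zero, mul_zero]

end Shift

section QuotientOperators

/-- The operators on functions that commute with the action of `G`. -/
def IsEquivariant (G : Type*) {P K : Type*} [Group G] [MulAction G P] [Semiring K]
    (U : Module.End K (P → K)) : Prop :=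
  ∀ (g : G) (f : P → K) (p : P), U (fun x => f (g • x)) p = U f (g • p)

variable {G P K : Type*} [Group G] [MulAction G P]

theorem isEquivariant_relSum [Semiring K] [Fintype P] {r : P → P → Prop}
    (hr : ∀ (g : G) (x y : P), r x y → r (g • x) (g • y)) : IsEquivariant G (relSum K r) := by
  classical
  intro g f p
  refine Finset.sum_equiv (MulAction.toPerm g) (fun x => ?_) fun x _ => rfl
  simp only [Finset.mem_filter, Finset.mem_univ, true_and, MulAction.toPerm_apply]
  exact ⟨hr g x p, fun h => by simpa using hr g⁻¹ _ _ h⟩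

namespace QuotientPoset

/-- The restriction of an equivariant operator to the `G`-invariant functions, which are identified
with the functions on the set of orbits. -/
def quotientEnd [Semiring K] (U : Module.End K (P → K)) (hU : IsEquivariant G U) :
    Module.End K (QuotientPoset G P → K) where
  toFun f := Quotient.lift (s := MulAction.orbitRel G P) (U (f ∘ mk)) <| by
    rintro _ p ⟨g, rfl⟩
    change U (f ∘ mk) (g • p) = U (f ∘ mk) p
    have hinv : (fun x => (f ∘ mk) (g • x)) = f ∘ mk :=
      funext fun x => congrArg f (mk_eq_iff.2 ⟨g, rfl⟩)
    rw [← hU g, hinv]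
  map_add' f h := by
    ext O
    obtain ⟨p, rfl⟩ := mk_surjective O
    exact congrFun (map_add U (f ∘ mk) (h ∘ mk)) p
  map_smul' c f := by
    ext O
    obtain ⟨p, rfl⟩ := mk_surjective O
    exact congrFun (map_smul U c (f ∘ mk)) p

theorem quotientEnd_comp_mk [Semiring K] {U : Module.End K (P → K)} (hU : IsEquivariant G U)
    (f : QuotientPoset G P → K) : quotientEnd U hU f ∘ mk = U (f ∘ mk) := rfl

theorem quotientEnd_pow_comp_mk [Semiring K] {U : Module.End K (P → K)} (hU : IsEquivariant G U)
    (k : ℕ) (f : QuotientPoset G P → K) : (quotientEnd U hU ^ k) f ∘ mk = (U ^ k) (f ∘ mk) := by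
  induction k with
  | zero => rfl
  | succ k ih =>
    rw [pow_succ', pow_succ', Module.End.mul_apply, Module.End.mul_apply, quotientEnd_comp_mk, ih]

variable [PartialOrder P] [GradeOrder ℕ P] [IsGradedAction G P]

theorem mk_covBy_mk {p q : P} (h : p ⋖ q) : (mk p : QuotientPoset G P) ⋖ mk q :=
  (covBy_iff_le_and_grade _ _).2
    ⟨⟨p, q, rfl, rfl, h.le⟩, ((covBy_iff_le_and_grade p q).1 h).2⟩

theorem isSupportedOn_quotientEnd [Semiring K] {U : Module.End K (P → K)}
    (hU : IsEquivariant G U) (hsupp : IsSupportedOn (· ⋖ ·) U) :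
    IsSupportedOn (· ⋖ ·) (quotientEnd U hU) := by
  intro f O hf
  obtain ⟨p, rfl⟩ := mk_surjective O
  exact hsupp (f ∘ mk) p fun x hx => hf (mk x) (mk_covBy_mk hx)

theorem isLefschetz_quotientEnd [DivisionRing K] [Finite P] {U : Module.End K (P → K)}
    (hU : IsEquivariant G U) {N : ℕ} (hN : IsLefschetz U N) :
    IsLefschetz (quotientEnd U hU) N := by
  intro i k hik f hf hpow
  have hmem : f ∘ mk ∈ rankSpace K P i :=
    mem_rankSpace_iff.2 fun p hp => mem_rankSpace_iff.1 hf (mk p) hp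
  have hzero : f ∘ mk = 0 :=
    hN i k hik _ hmem (by rw [← quotientEnd_pow_comp_mk hU, hpow]; rfl)
  exact mk_surjective.injective_comp_right hzero

end QuotientPoset

theorem EdgePoset.isShift_smul [PartialOrder P] [GradeOrder ℕ P] [IsGradedAction G P] (g : G)
    {e e' : EdgePoset P} (h : IsShift e e') : IsShift (g • e) (g • e') :=
  ⟨⟨IsGradedAction.smul_covBy g h.1.1, IsGradedAction.smul_covBy g h.1.2⟩,
    fun heq => h.2 (MulAction.injective g heq)⟩

end QuotientOperators

section Complement

theorem isRankSymmetric_of_involutive {P : Type*} [PartialOrder P] [GradeOrder ℕ P] {φ : P → P}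
    (hφ : Function.Involutive φ) {N : ℕ} (hgrade : ∀ p, grade ℕ (φ p) + grade ℕ p = N) :
    IsRankSymmetric P N := by
  intro i hi
  have himage : {p : P | grade ℕ p = N - i} = φ '' {p | grade ℕ p = i} := by
    rw [Set.image_eq_preimage_of_inverse hφ.leftInverse hφ.rightInverse]
    ext p
    have := hgrade p
    simp only [Set.mem_ofPred_eq, Set.mem_preimage]
    omega
  rw [rankNumber, rankNumber, himage, Set.ncard_image_of_injective _ hφ.injective]

theorem isOfRank_of_grade_add_grade {P : Type*} [PartialOrder P] [GradeOrder ℕ P] {φ : P → P}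
    {N : ℕ} (hgrade : ∀ p, grade ℕ (φ p) + grade ℕ p = N)
    (hzero : Nonempty P → ∃ p : P, grade ℕ p = 0) : IsOfRank P N := by
  refine ⟨fun p => (Nat.le_add_left _ _).trans_eq (hgrade p), fun hP => ?_⟩
  obtain ⟨p, hp⟩ := hzero hP
  exact ⟨⟨p, hp⟩, φ p, by rw [← hgrade p, hp, add_zero]⟩

namespace QuotientPoset

variable {G P : Type*} [Group G] [MulAction G P]

/-- The map on orbits induced by an equivariant map. -/
def map (φ : P → P) (hφ : ∀ (g : G) p, φ (g • p) = g • φ p) :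
    QuotientPoset G P → QuotientPoset G P :=
  Quotient.map' (s₁ := MulAction.orbitRel G P) (s₂ := MulAction.orbitRel G P) φ <| by
    rintro _ p ⟨g, rfl⟩
    exact ⟨g, (hφ g p).symm⟩

theorem map_involutive {φ : P → P} (hφ : ∀ (g : G) p, φ (g • p) = g • φ p)
    (hinv : Function.Involutive φ) : Function.Involutive (map φ hφ) := by
  intro O
  obtain ⟨p, rfl⟩ := mk_surjective O
  exact congrArg mk (hinv p)

end QuotientPoset

namespace EdgePoset

theorem exists_grade_eq_zero {α : Type*} (e : EdgePoset (Finset α)) :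
    ∃ e' : EdgePoset (Finset α), grade ℕ e' = 0 := by
  classical
  obtain ⟨a, -⟩ := exists_eq_ofNotMem e
  exact ⟨ofNotMem (Finset.notMem_empty a), Finset.card_empty (α := α)⟩

/-- Complementation reverses the edges of a Boolean algebra: `(x, y)` goes to `(yᶜ, xᶜ)`. -/
def compl {P : Type*} [BooleanAlgebra P] (e : EdgePoset P) : EdgePoset P :=
  ⟨e.sndᶜ, e.fstᶜ, ((apply_covBy_apply_iff (OrderIso.compl P)).2 e.covBy).ofDual⟩

theorem compl_involutive {P : Type*} [BooleanAlgebra P] :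
    Function.Involutive (compl : EdgePoset P → EdgePoset P) :=
  fun e => EdgePoset.ext (compl_compl e.fst) (compl_compl e.snd)

end EdgePoset

theorem IsGradedAction.smul_compl {G P : Type*} [Group G] [BooleanAlgebra P] [GradeOrder ℕ P]
    [MulAction G P] [IsGradedAction G P] (g : G) (x : P) : g • xᶜ = (g • x)ᶜ :=
  map_compl' (⟨MulAction.toPerm g, IsGradedAction.smul_le_smul_iff' g _ _⟩ : P ≃o P) x

theorem EdgePoset.compl_smul {G P : Type*} [Group G] [BooleanAlgebra P] [GradeOrder ℕ P]
    [MulAction G P] [IsGradedAction G P] (g : G) (e : EdgePoset P) :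
    (g • e).compl = g • e.compl :=
  EdgePoset.ext (IsGradedAction.smul_compl g e.snd).symm (IsGradedAction.smul_compl g e.fst).symm

end Complement

theorem mainTheorem2_general {α G : Type*} [Finite α] [Group G] [MulAction G (Finset α)]
    [IsGradedAction G (Finset α)] : IsPeck (QuotientPoset G (EdgePoset (Finset α))) := by
  classical
  have := Fintype.ofFinite α
  have := Fintype.ofFinite (EdgePoset (Finset α))
  have hequiv : IsEquivariant G (relSum ℚ (EdgePoset.IsShift (P := Finset α))) :=
    isEquivariant_relSum fun g _ _ => EdgePoset.isShift_smul g
  have hsupp := QuotientPoset.isSupportedOn_quotientEnd hequiv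
    ((isSupportedOn_relSum _).mono fun _ _ h => h.covBy)
  have hLefschetz := QuotientPoset.isLefschetz_quotientEnd hequiv
    EdgePoset.isLefschetz_relSum_isShift
  have hgrade : ∀ O : QuotientPoset G (EdgePoset (Finset α)),
      grade ℕ (QuotientPoset.map EdgePoset.compl EdgePoset.compl_smul O) + grade ℕ O =
        Fintype.card α - 1 := fun O => by
    obtain ⟨e, rfl⟩ := QuotientPoset.mk_surjective O
    exact EdgePoset.card_compl_snd_add_card_fst e
  refine hLefschetz.isPeck hsupp (isOfRank_of_grade_add_grade hgrade ?_)
    (isRankSymmetric_of_involutive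
      (QuotientPoset.map_involutive _ EdgePoset.compl_involutive) hgrade)
  rintro ⟨O⟩
  obtain ⟨e, rfl⟩ := QuotientPoset.mk_surjective O
  obtain ⟨e', he'⟩ := EdgePoset.exists_grade_eq_zero e
  exact ⟨QuotientPoset.mk e', he'⟩

theorem mainTheorem2 (n : ℕ) (G : Subgroup (Finset (Fin n) ≃o Finset (Fin n))) :
    IsPeck (QuotientPoset G (EdgePoset (Finset (Fin n)))) :=
  mainTheorem2_general
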